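/- Rings are commutative with $1$. Let $k$ be a field, let $\mathbb{N}_0=\{0,1,2,\dots\}$, and let $$H=\{(a,b)\in\mathbb{N}_0^2 : 0\le b/a<\infty\}\cup\{(0,0)\}=\{(a,b)\in\mathbb{N}_0^2 : a\neq 0\}\cup\{(0,0)\}.$$ The following notions are used. * A submonoid $C\subseteq\mathbb{Z}^n$ is *normal* if $c-c'\in C$ whenever $c,c'\in C$ and $m(c-c')\in C$ for some integer $m>0$. * A sequence $x_1,\dots,x_\ell$ in a ring $R$ is *weakly regular* on an $R$-module $M$ if each $x_i$ is a nonzerodivisor on $M/(x_1,\dots,x_{i-1})M$; it is *regular* if moreover $(x_1,\dots,x_\ell)M\ne M$. The classical grade $\operatorname{c.grade}_R(\mathfrak a,M)$ is the supremum of the lengths of the weakly regular sequences on $M$ contained in the ideal $\mathfrak a$, and the polynomial grade is $\operatorname{p.grade}_R(\mathfrak a,M)=\lim_{m\to\infty}\operatorname{c.grade}_{R[t_1,\dots,t_m]}(\mathfrak aR[t_1,\dots,t_m],R[t_1,\dots,t_m]\otimes_RM)$. The ring $R$ is *Cohen–Macaulay in the sense of ideals* if $\operatorname{ht}\mathfrak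 a=\operatorname{p.grade}_R(\mathfrak a,R)$ for every ideal $\mathfrak a$ (with $\operatorname{ht}R=\infty$). * A prime $\mathfrak p$ is *weakly associated* to an $R$-module $M$ if it is minimal over $(0:_Rm)$ for some $m\in M$. The ring $R$ is *weak Bourbaki unmixed* if for every finitely generated ideal $\mathfrak a$ whose height is at least its minimal number of generators, the weakly associated primes of $R/\mathfrak a$ are exactly the minimal primes of $\mathfrak a$. * A sequence $\underline x=x_1,\dots,x_\ell$ in $R$ ($\ell\geq 1$) is *weakly proregular* if for each $n>0$ there is $m\ge n$ such that the map of Koszul complexes $\mathbb K_\bullet(x_1^m,\dots,x_\ell^m)\to\mathbb K_\bullet(x_1^n,\dots,x_\ell^n)$ induced by $e_j\mapsto x_j^{m-n}e_j$ is zero on $H_i$ for all $i\ge1$. It is a *parameter sequence* if it is weakly proregular, $(\underline x)R\neq R$, and the top Čech cohomology satisfies $H^\ell_{\underline x}(R)_{\mathfrak p}\ne0$ for every prime $\mathfrak p\supseteq(\underline x)R$. It is a *strong parameter sequence* if $x_1,\dots,x_i$ is a parameter sequence for all $1\le i\le\ell$. The ring $R$ is *Cohen–Macaulay in the sense of Hamilton–Marley*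 if every strong parameter sequence on $R$ is a regular sequence on $R$. **Theorem.** $H$ is a normal submonoid of $\mathbb{Z}^2$, and the assignment $(a,b)\mapsto x^ay^b$ induces an isomorphism of $k$-algebras from the semigroup ring $k[H]$ onto $k+x\,k[x,y]\subseteq k[x,y]$. Moreover: 1. $k[H]$ is not Cohen–Macaulay in the sense of ideals; 2. $k[H]$ is not weak Bourbaki unmixed; 3. $k[H]$ is Cohen–Macaulay in the sense of Hamilton–Marley. -/

import Mathlib

open scoped TensorProduct

noncomputable section

namespace NonNoethCM

universe u v

/-! ### The semigroup `H` and the ring `k + x k[x, y]` -/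

/-- A submonoid `C` of an abelian group is normal if, for `c, c' ∈ C` and a positive integer `n`,
`n (c - c') ∈ C` implies `c - c' ∈ C`. -/
def IsNormalSubmonoid {G : Type u} [AddCommGroup G] (C : AddSubmonoid G) : Prop :=
  ∀ c ∈ C, ∀ c' ∈ C, ∀ n : ℕ, 0 < n → n • (c - c') ∈ C → c - c' ∈ C

/-- `H = {(a, b) ∈ ℕ² : 0 ≤ b / a < ∞} ∪ {(0, 0)}`; the condition `0 ≤ b / a < ∞` means that
the fraction is defined and finite, that is, `a ≠ 0`. -/
def H : AddSubmonoid (ℕ × ℕ) where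
  carrier := {p | p.1 ≠ 0} ∪ {(0, 0)}
  zero_mem' := Or.inr rfl
  add_mem' := by
    rintro ⟨a, b⟩ ⟨c, d⟩ h₁ h₂
    simp only [Set.mem_union, Set.mem_ofPred_eq, Set.mem_singleton_iff, Prod.mk.injEq,
      Prod.mk_add_mk] at h₁ h₂ ⊢
    omega

/-- `H` viewed inside `ℤ²`. -/
def HInt : AddSubmonoid (ℤ × ℤ) :=
  H.map ((Nat.castAddMonoidHom ℤ).prodMap (Nat.castAddMonoidHom ℤ))

/-- The subalgebra `k + x k[x, y]` of `k[x, y]`, where `x = X 0` and `y = X 1`. -/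
def kAddXPoly (k : Type u) [Field k] : Subalgebra k (MvPolynomial (Fin 2) k) where
  carrier := {p | ∃ (c : k) (f : MvPolynomial (Fin 2) k),
    p = MvPolynomial.C c + MvPolynomial.X 0 * f}
  algebraMap_mem' c := ⟨c, 0, by simp [MvPolynomial.algebraMap_eq]⟩
  add_mem' := by
    rintro _ _ ⟨c, f, rfl⟩ ⟨d, g, rfl⟩
    exact ⟨c + d, f + g, by rw [map_add]; ring⟩
  mul_mem' := by
    rintro _ _ ⟨c, f, rfl⟩ ⟨d, g, rfl⟩
    exact ⟨c * d, MvPolynomial.C c * g + f * MvPolynomial.C d + MvPolynomial.X 0 * f * g, by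
      rw [map_mul]; ring⟩

/-! ### Polynomial grade, Cohen-Macaulayness in the sense of ideals -/

/-- The classical grade of the ideal `I` on `M`: the supremum of the lengths of all weak regular
sequences on `M` contained in `I`. -/
def classicalGrade {R : Type u} [CommRing R] (I : Ideal R) (M : Type v) [AddCommGroup M]
    [Module R M] : ℕ∞ :=
  ⨆ (rs : List R) (_ : RingTheory.Sequence.IsWeaklyRegular M rs ∧ ∀ r ∈ rs, r ∈ I),
    (rs.length : ℕ∞)

theorem le_classicalGrade {R : Type u} [CommRing R] {I : Ideal R} {M : Type v} [AddCommGroup M]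
    [Module R M] {rs : List R} (h : RingTheory.Sequence.IsWeaklyRegular M rs)
    (h' : ∀ r ∈ rs, r ∈ I) : (rs.length : ℕ∞) ≤ classicalGrade I M :=
  le_iSup₂_of_le rs ⟨h, h'⟩ le_rfl

theorem isWeaklyRegular_baseChange (R S T : Type u) [CommRing R] [CommRing S] [CommRing T]
    [Algebra R S] [Algebra R T] [Algebra S T] [IsScalarTower R S T] [Module.Flat S T]
    (M : Type v) [AddCommGroup M] [Module R M] {rs : List S}
    (h : RingTheory.Sequence.IsWeaklyRegular (S ⊗[R] M) rs) :
    RingTheory.Sequence.IsWeaklyRegular (T ⊗[R] M) (rs.map (algebraMap S T)) :=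
  (LinearEquiv.isWeaklyRegular_congr
    (TensorProduct.AlgebraTensorModule.cancelBaseChange R S T T M) _).mp
      (h.of_flat_of_isBaseChange (TensorProduct.isBaseChange S (S ⊗[R] M) T))

/-- The classical grade of `I R[t₁, …, tₘ]` on `R[t₁, …, tₘ] ⊗ M`. -/
def classicalGradeExt {R : Type u} [CommRing R] (I : Ideal R) (M : Type v) [AddCommGroup M]
    [Module R M] (m : ℕ) : ℕ∞ :=
  classicalGrade (I.map (algebraMap R (MvPolynomial (Fin m) R))) (MvPolynomial (Fin m) R ⊗[R] M)

/-- The polynomial grade of `I` on `M`: the limit, as `m → ∞`, of the classical grades of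
`I R[t₁, …, tₘ]` on `R[t₁, …, tₘ] ⊗ M`. These are non-decreasing in `m`, so the limit is
the supremum, see `tendsto_classicalGradeExt`. -/
def polynomialGrade {R : Type u} [CommRing R] (I : Ideal R) (M : Type v) [AddCommGroup M]
    [Module R M] : ℕ∞ :=
  ⨆ m : ℕ, classicalGradeExt I M m

theorem flat_rename_castSucc (R : Type u) [CommRing R] (m : ℕ) :
    (MvPolynomial.rename (R := R) (Fin.castSucc (n := m))).toRingHom.Flat := by
  let e := (MvPolynomial.renameEquiv R
    ((finSumFinEquiv (m := m) (n := 1)).symm.trans (Equiv.sumComm _ _))).trans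
      (MvPolynomial.sumAlgEquiv R (Fin 1) (Fin m))
  have he : (MvPolynomial.rename (R := R) (Fin.castSucc (n := m))).toRingHom
      = (e.symm.toRingEquiv.toRingHom).comp
        (algebraMap (MvPolynomial (Fin m) R) (MvPolynomial (Fin 1) (MvPolynomial (Fin m) R))) := by
    refine RingHom.ext fun p => ?_
    change _ = e.symm (MvPolynomial.C p)
    rw [AlgEquiv.eq_symm_apply]
    change ((e.toAlgHom.comp (MvPolynomial.rename Fin.castSucc)) p) =
      (IsScalarTower.toAlgHom R (MvPolynomial (Fin m) R)
        (MvPolynomial (Fin 1) (MvPolynomial (Fin m) R))) p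
    congr 1
    refine MvPolynomial.algHom_ext fun i => ?_
    simp [e, MvPolynomial.algebraMap_eq, MvPolynomial.sumAlgEquiv_X_inr]
  rw [he]
  refine RingHom.Flat.comp ?_ (RingHom.Flat.of_bijective e.symm.bijective)
  rw [RingHom.flat_algebraMap_iff]
  infer_instance

theorem classicalGradeExt_le_succ {R : Type u} [CommRing R] (I : Ideal R) (M : Type v)
    [AddCommGroup M] [Module R M] (m : ℕ) :
    classicalGradeExt I M m ≤ classicalGradeExt I M (m + 1) := by
  let f : MvPolynomial (Fin m) R →ₐ[R] MvPolynomial (Fin (m + 1)) R :=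
    MvPolynomial.rename Fin.castSucc
  algebraize [f.toRingHom]
  have hcomp : (algebraMap (MvPolynomial (Fin m) R) (MvPolynomial (Fin (m + 1)) R)).comp
      (algebraMap R (MvPolynomial (Fin m) R)) = algebraMap R (MvPolynomial (Fin (m + 1)) R) :=
    f.comp_algebraMap
  have : IsScalarTower R (MvPolynomial (Fin m) R) (MvPolynomial (Fin (m + 1)) R) :=
    IsScalarTower.of_algebraMap_eq' hcomp.symm
  have : Module.Flat (MvPolynomial (Fin m) R) (MvPolynomial (Fin (m + 1)) R) :=
    flat_rename_castSucc R m
  refine iSup₂_le fun rs hrs => ?_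
  have hreg := isWeaklyRegular_baseChange R _ (MvPolynomial (Fin (m + 1)) R) M hrs.1
  refine le_trans (le_of_eq ?_) (le_classicalGrade hreg ?_)
  · simp
  · intro r hr
    obtain ⟨s, hs, rfl⟩ := List.mem_map.mp hr
    rw [← hcomp, ← Ideal.map_map]
    exact Ideal.mem_map_of_mem _ (hrs.2 s hs)

theorem tendsto_classicalGradeExt {R : Type u} [CommRing R] (I : Ideal R) (M : Type v)
    [AddCommGroup M] [Module R M] :
    Filter.Tendsto (classicalGradeExt I M) Filter.atTop (nhds (polynomialGrade I M)) :=
  tendsto_atTop_iSup (monotone_nat_of_le_succ (classicalGradeExt_le_succ I M))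

/-- Cohen-Macaulay in the sense of ideals: height equals polynomial grade for every ideal (both
are `⊤` for the unit ideal). -/
def IsCohenMacaulayIdeals (A : Type u) [CommRing A] : Prop :=
  ∀ I : Ideal A, I.height = polynomialGrade I A

/-! ### Weak Bourbaki unmixed rings -/

/-- The weakly associated primes of `M`: the primes minimal over the annihilator of some
element of `M`. -/
def weaklyAssociatedPrimes (A : Type u) [CommRing A] (M : Type v) [AddCommGroup M] [Module A M] :
    Set (Ideal A) :=
  {p | ∃ m : M, p ∈ (Ideal.torsionOf A M m).minimalPrimes}

/-- Weak Bourbaki unmixed: for every finitely generated ideal `I` whose height is at least its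
minimal number of generators, the weakly associated primes of `A / I` are exactly
the minimal primes of `I`. -/
def IsWeakBourbakiUnmixed (A : Type u) [CommRing A] : Prop :=
  ∀ I : Ideal A, I.FG → (Submodule.spanFinrank I : ℕ∞) ≤ I.height →
    weaklyAssociatedPrimes A (A ⧸ I) = I.minimalPrimes

/-! ### The Koszul complex and weakly proregular sequences -/

section Koszul

variable {R : Type u} [CommRing R] {ℓ : ℕ}

theorem contractLeft_mem_exteriorPower {M : Type v} [AddCommGroup M] [Module R M]
    (f : Module.Dual R M) (i : ℕ) (z : ExteriorAlgebra R M) (hz : z ∈ ⋀[R]^(i + 1) M) :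
    CliffordAlgebra.contractLeft (Q := (0 : QuadraticForm R M)) f z ∈ ⋀[R]^i M := by
  induction i generalizing z with
  | zero =>
    rw [zero_add, ExteriorAlgebra.exteriorPower, pow_one] at hz
    obtain ⟨m, rfl⟩ := hz
    rw [ExteriorAlgebra.exteriorPower, pow_zero, Submodule.mem_one]
    exact ⟨f m, (CliffordAlgebra.contractLeft_ι (Q := (0 : QuadraticForm R M)) f m).symm⟩
  | succ i ih =>
    rw [ExteriorAlgebra.exteriorPower, pow_succ'] at hz
    induction hz using Submodule.mul_induction_on' with
    | mem_mul_mem a ha b hb =>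
      obtain ⟨m, rfl⟩ := ha
      have h := CliffordAlgebra.contractLeft_ι_mul (Q := (0 : QuadraticForm R M)) (d := f) m b
      rw [ExteriorAlgebra.ι, h]
      refine Submodule.sub_mem _ (Submodule.smul_mem _ _ hb) ?_
      rw [ExteriorAlgebra.exteriorPower, pow_succ']
      exact Submodule.mul_mem_mul ⟨m, rfl⟩ (ih b hb)
    | add a _ b _ ha hb =>
      rw [map_add]
      exact Submodule.add_mem _ ha hb

theorem coe_exteriorPower_map {M : Type v} [AddCommGroup M] [Module R M] (g : M →ₗ[R] M) (i : ℕ)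
    (z : ⋀[R]^i M) : (exteriorPower.map i g z : ExteriorAlgebra R M) = ExteriorAlgebra.map g z := by
  have : (⋀[R]^i M).subtype ∘ₗ exteriorPower.map i g =
      (ExteriorAlgebra.map g).toLinearMap ∘ₗ (⋀[R]^i M).subtype := by
    refine exteriorPower.linearMap_ext ?_
    ext v
    simp [ExteriorAlgebra.map_apply_ιMulti]
  exact LinearMap.congr_fun this z

theorem contractLeft_map {M : Type v} [AddCommGroup M] [Module R M] (f : Module.Dual R M)
    (g : M →ₗ[R] M) (z : ExteriorAlgebra R M) :
    CliffordAlgebra.contractLeft (Q := (0 : QuadraticForm R M)) f (ExteriorAlgebra.map g z) =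
      ExteriorAlgebra.map g
        (CliffordAlgebra.contractLeft (Q := (0 : QuadraticForm R M)) (f ∘ₗ g) z) := by
  induction z using CliffordAlgebra.left_induction with
  | algebraMap r =>
    rw [CliffordAlgebra.contractLeft_algebraMap, AlgHom.commutes,
      CliffordAlgebra.contractLeft_algebraMap, map_zero]
  | add x y hx hy => simp only [map_add, hx, hy]
  | ι_mul x m hx =>
    have h : ExteriorAlgebra.map g (CliffordAlgebra.ι (0 : QuadraticForm R M) m) =
        CliffordAlgebra.ι (0 : QuadraticForm R M) (g m) := ExteriorAlgebra.map_apply_ι g m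
    rw [map_mul, h, CliffordAlgebra.contractLeft_ι_mul, CliffordAlgebra.contractLeft_ι_mul, hx,
      map_sub, map_smul, map_mul, h, LinearMap.comp_apply]

/-- The differential `⋀^{i+1} R^ℓ → ⋀^i R^ℓ` of the Koszul complex of `x`: the contraction by the
functional `e_j ↦ x_j`, so that
`e_{j_0} ∧ … ∧ e_{j_i} ↦ ∑_s (-1)^s x_{j_s} e_{j_0} ∧ … (omit e_{j_s}) … ∧ e_{j_i}`. -/
def koszulD (x : Fin ℓ → R) (i : ℕ) : ⋀[R]^(i + 1) (Fin ℓ → R) →ₗ[R] ⋀[R]^i (Fin ℓ → R) :=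
  (CliffordAlgebra.contractLeft (Q := (0 : QuadraticForm R (Fin ℓ → R)))
    (Fintype.linearCombination R x)).restrict
      (contractLeft_mem_exteriorPower (Fintype.linearCombination R x) i)

theorem koszulD_comp (x : Fin ℓ → R) (i : ℕ) : koszulD x i ∘ₗ koszulD x (i + 1) = 0 := by
  refine LinearMap.ext fun z => Subtype.ext ?_
  exact CliffordAlgebra.contractLeft_contractLeft _ _

/-- The map `e_j ↦ (x_j)^{m-n} e_j` on exterior powers of `R^ℓ`; for `m ≥ n` this is the
component in degree `i` of the chain map `K(x^m) → K(x^n)` (identity in degree `0`,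
multiplication by `(∏ x_j)^{m-n}` in degree `ℓ`). -/
def koszulPhi (x : Fin ℓ → R) (m n i : ℕ) : ⋀[R]^i (Fin ℓ → R) →ₗ[R] ⋀[R]^i (Fin ℓ → R) :=
  exteriorPower.map i (LinearMap.pi fun j => (x j ^ (m - n)) • LinearMap.proj j)

theorem koszulPhi_comm (x : Fin ℓ → R) {m n : ℕ} (h : n ≤ m) (i : ℕ) :
    koszulD (fun j => x j ^ n) i ∘ₗ koszulPhi x m n (i + 1) =
      koszulPhi x m n i ∘ₗ koszulD (fun j => x j ^ m) i := by
  have hf : (Fintype.linearCombination R fun j => x j ^ n) ∘ₗ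
      (LinearMap.pi fun j => (x j ^ (m - n)) • LinearMap.proj j) =
        Fintype.linearCombination R fun j => x j ^ m := by
    refine LinearMap.ext fun v => ?_
    simp only [LinearMap.comp_apply, Fintype.linearCombination_apply, LinearMap.pi_apply,
      LinearMap.smul_apply, LinearMap.proj_apply, smul_eq_mul]
    refine Finset.sum_congr rfl fun j _ => ?_
    rw [← Nat.sub_add_cancel h, pow_add, Nat.add_sub_cancel]
    ring
  refine LinearMap.ext fun z => Subtype.ext ?_
  change CliffordAlgebra.contractLeft (Q := (0 : QuadraticForm R (Fin ℓ → R))) _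
    (koszulPhi x m n (i + 1) z : ExteriorAlgebra R (Fin ℓ → R)) =
      (koszulPhi x m n i (koszulD (fun j => x j ^ m) i z) : ExteriorAlgebra R (Fin ℓ → R))
  rw [koszulPhi, koszulPhi, coe_exteriorPower_map, coe_exteriorPower_map, contractLeft_map, hf]
  rfl

/-- `x` is weakly proregular: for each `n > 0` there is `m ≥ n` such that `K(x^m) → K(x^n)` is zero
on `H_{i+1}` for all `i ≥ 0`, i.e. carries cycles of degree `i + 1` to boundaries. -/
def IsWeaklyProregular (x : Fin ℓ → R) : Prop :=
  ∀ n : ℕ, 0 < n → ∃ m : ℕ, n ≤ m ∧ ∀ i : ℕ,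
    ∀ z ∈ LinearMap.ker (koszulD (fun j => x j ^ m) i),
      koszulPhi x m n (i + 1) z ∈ LinearMap.range (koszulD (fun j => x j ^ n) (i + 1))

end Koszul

/-! ### Čech cohomology -/

section Cech

variable {R : Type u} [CommRing R] {ℓ : ℕ}

/-- The localization `R_{x_S}` of `R` at the product `x_S` of the `x_j` with `j ∈ S`. -/
abbrev CechLoc (x : Fin ℓ → R) (S : Finset (Fin ℓ)) : Type u :=
  Localization.Away (∏ j ∈ S, x j)

theorem isUnit_cechLoc (x : Fin ℓ → R) {S T : Finset (Fin ℓ)} (h : S ⊆ T)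
    (r : Submonoid.powers (∏ j ∈ S, x j)) :
    IsUnit (Algebra.ofId R (CechLoc x T) (r : R)) := by
  obtain ⟨_, n, rfl⟩ := r
  have h1 : IsUnit (algebraMap R (CechLoc x T) (∏ j ∈ T, x j)) :=
    IsLocalization.Away.algebraMap_isUnit _
  have h2 : (∏ j ∈ S, x j) ∣ ∏ j ∈ T, x j := Finset.prod_dvd_prod_of_subset _ _ _ h
  simpa [Algebra.ofId_apply] using (isUnit_of_dvd_unit (map_dvd _ h2) h1).pow n

/-- The canonical localization map `R_{x_S} → R_{x_T}` for `S ⊆ T`. -/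
def cechRes (x : Fin ℓ → R) {S T : Finset (Fin ℓ)} (h : S ⊆ T) :
    CechLoc x S →ₐ[R] CechLoc x T :=
  IsLocalization.liftAlgHom (M := Submonoid.powers (∏ j ∈ S, x j)) (f := Algebra.ofId R _)
    (isUnit_cechLoc x h)

/-- The Čech cochains of degree `p`: the product of the `R_{x_S}` over all `S` of size `p`. -/
abbrev CechCochain (x : Fin ℓ → R) (p : ℕ) : Type u :=
  ∀ S : {S : Finset (Fin ℓ) // S.card = p}, CechLoc x S.1

/-- The Čech differential: the component of `d c` at `T = {j_0 < … < j_p}` is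
`∑_s (-1)^s c_{T \ {j_s}}`, where `s` is the number of elements of `T` below `j_s`. -/
def cechD (x : Fin ℓ → R) (p : ℕ) : CechCochain x p →ₗ[R] CechCochain x (p + 1) :=
  LinearMap.pi fun T => ∑ j : T.1, (-1 : R) ^ ((T.1.filter (· < j.1)).card) •
    ((cechRes x (Finset.erase_subset j.1 T.1)).toLinearMap ∘ₗ
      LinearMap.proj (⟨T.1.erase j.1, by
        rw [Finset.card_erase_of_mem j.2, T.2, Nat.add_sub_cancel]⟩ :
          {S : Finset (Fin ℓ) // S.card = p}))

/-- The Čech coboundaries of degree `p`. -/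
def cechBoundaries (x : Fin ℓ → R) : (p : ℕ) → Submodule R (CechCochain x p)
  | 0 => ⊥
  | p + 1 => LinearMap.range (cechD x p)

/-- The `p`-th Čech cohomology of `R` with respect to `x`: cocycles modulo coboundaries. -/
abbrev CechCohomology (x : Fin ℓ → R) (p : ℕ) : Type u :=
  LinearMap.ker (cechD x p) ⧸ (cechBoundaries x p).submoduleOf (LinearMap.ker (cechD x p))

end Cech

/-! ### Cohen-Macaulayness in the sense of Hamilton-Marley -/

section HM

variable {R : Type u} [CommRing R] {ℓ : ℕ}

/-- `x = x_1, …, x_ℓ` is a parameter sequence on `R`: it is weakly proregular, generates a proper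
ideal, and `H^ℓ_x(R)_p ≠ 0` for every prime `p` containing this ideal. -/
structure IsParameterSequence (x : Fin ℓ → R) : Prop where
  weaklyProregular : IsWeaklyProregular x
  ne_top : Ideal.span (Set.range x) ≠ ⊤
  cech_nontrivial : ∀ (p : Ideal R) [p.IsPrime], Ideal.span (Set.range x) ≤ p →
    Nontrivial (LocalizedModule p.primeCompl (CechCohomology x ℓ))

/-- Every initial segment `x_1, …, x_i` with `1 ≤ i ≤ ℓ` is a parameter sequence. -/
def IsStrongParameterSequence (x : Fin ℓ → R) : Prop :=
  ∀ (i : ℕ) (h : i ≤ ℓ), 1 ≤ i → IsParameterSequence fun j : Fin i => x (Fin.castLE h j)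

/-- Cohen-Macaulay in the sense of Hamilton-Marley: every (nonempty) strong parameter sequence is a
regular sequence. -/
def IsCohenMacaulayHM (R : Type u) [CommRing R] : Prop :=
  ∀ (ℓ : ℕ) (x : Fin ℓ → R), 1 ≤ ℓ → IsStrongParameterSequence x →
    RingTheory.Sequence.IsRegular R (List.ofFn x)

end HM

end NonNoethCM

end

namespace NonNoethCM

/-! ### Vanishing of the top Čech cohomology at a prime -/

/-! Write `B = k[x, y]`, let `A` be the subring `k + xB`, and `m = xB`, a maximal ideal of `A` that
is also an ideal of `B`. The arguments use only the shape of `A` (`IsConstAddMul`) and that `B` is a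
factorial domain of dimension at most two, with a second prime `y` for the negative results.

The failures come from `m` being stable under multiplication by `y ∉ A`. For `r, s ∈ m` the relation
`s (y r) = r (y s)` prevents `r, s` from being regular, also after adjoining variables, so `m` has
polynomial grade at most one. But `0 < yB ∩ A < m` gives height at least two. Likewise `m` is the
annihilator of `xy²` in `A/(xy)`, yet it is not minimal over `(xy)`.

For Hamilton–Marley, the top Čech cohomology controls strong parameter sequences. If two terms share
a prime factor `q` in `B`, it vanishes at `m` (when `q` is associated to `x`) or at `qB ∩ A`. So the
first two terms are coprime in `B`, which already makes them regular on `A`. A third term is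
impossible: a maximal ideal containing all three is not `m`, so it lies in some `Q ∩ A` with `x ∉
Q`, and near `Q` a power of the third term lies in the ideal of powers of the first two. -/

/-- The top Čech cohomology vanishes at `p` if, up to elements outside `p`, large powers of the
product of the sequence lie in the ideals generated by the powers of the sequence. -/
theorem subsingleton_localizedModule_cechCohomology {R : Type*} [CommRing R] {ℓ : ℕ}
    (x : Fin (ℓ + 1) → R) (p : Ideal R) [p.IsPrime]
    (h : ∀ n : ℕ, ∃ N : ℕ, ∃ s ∉ p,
      s * (∏ j, x j) ^ N ∈ Ideal.span (Set.range fun j => x j ^ (n + N))) :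
    Subsingleton (LocalizedModule p.primeCompl (CechCohomology x (ℓ + 1))) := by
  rw [LocalizedModule.subsingleton_iff]
  intro z
  obtain ⟨c, rfl⟩ := Submodule.Quotient.mk_surjective _ z
  have hcard : (Finset.univ : Finset (Fin (ℓ + 1))).card = ℓ + 1 := by simp
  obtain ⟨α, ⟨_, n, rfl⟩, hc⟩ :=
    IsLocalization.exists_mk'_eq (Submonoid.powers (∏ j ∈ Finset.univ, x j)) (c.1 ⟨Finset.univ, hcard⟩)
  obtain ⟨N, s, hs, hmem⟩ := h n
  obtain ⟨a, ha⟩ := Ideal.mem_span_range_iff_exists_fun.mp hmem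
  refine ⟨s, hs, ?_⟩
  rw [← Submodule.Quotient.mk_smul, Submodule.Quotient.mk_eq_zero]
  -- With `P = ∏ x_j` and `c = α / P^n`, one has `s c = s P^N α / P^(n+N) = ∑ a_j x_j^(n+N) α /
  -- P^(n+N)`, and the `j`-th summand comes from the localization omitting `x_j`. The complement of
  -- `S` is a single `j`; the sign cancels the one in `cechD`.
  let w : CechCochain x ℓ := fun S => ∑ j ∈ S.1ᶜ,
    (-1 : R) ^ ((Finset.univ.filter (· < j)).card) •
      IsLocalization.mk' (CechLoc x S.1) (a j * α)
        (⟨(∏ i ∈ S.1, x i) ^ (n + N), pow_mem (Submonoid.mem_powers _) _⟩ : Submonoid.powers (∏ i ∈ S.1, x i))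
  refine ⟨w, ?_⟩
  funext ⟨T, hT⟩
  obtain rfl : T = Finset.univ := Finset.eq_univ_of_card T (by simpa using hT)
  have hP : IsUnit (algebraMap R (CechLoc x Finset.univ) (∏ j, x j)) :=
    IsLocalization.Away.algebraMap_isUnit _
  refine (hP.pow (n + N)).mul_left_injective ?_
  have hcα : c.1 ⟨Finset.univ, hcard⟩ * algebraMap R (CechLoc x Finset.univ) ((∏ j, x j) ^ n) =
      algebraMap R _ α := by
    rw [← hc]
    exact IsLocalization.mk'_spec _ _ _
  have hres : ∀ j : Fin (ℓ + 1),
      cechRes x (Finset.erase_subset j Finset.univ)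
        (IsLocalization.mk' (CechLoc x (Finset.univ.erase j)) (a j * α)
          (⟨(∏ i ∈ Finset.univ.erase j, x i) ^ (n + N), pow_mem (Submonoid.mem_powers _) _⟩ :
            Submonoid.powers (∏ i ∈ Finset.univ.erase j, x i))) *
        algebraMap R (CechLoc x Finset.univ) (∏ j, x j) ^ (n + N) =
      algebraMap R _ (a j * x j ^ (n + N) * α) := by
    intro j
    have h1 := congrArg (cechRes x (Finset.erase_subset j Finset.univ))
      (IsLocalization.mk'_spec (CechLoc x (Finset.univ.erase j)) (a j * α)
          (⟨(∏ i ∈ Finset.univ.erase j, x i) ^ (n + N), pow_mem (Submonoid.mem_powers _) _⟩ :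
            Submonoid.powers (∏ i ∈ Finset.univ.erase j, x i)))
    rw [map_mul, AlgHom.commutes, AlgHom.commutes] at h1
    have h2 : algebraMap R (CechLoc x Finset.univ) (∏ j, x j) =
        algebraMap R _ (x j) * algebraMap R _ (∏ i ∈ Finset.univ.erase j, x i) := by
      rw [← map_mul, Finset.mul_prod_erase Finset.univ x (Finset.mem_univ j)]
    rw [h2, mul_pow, mul_left_comm, ← map_pow, ← map_pow, h1, ← map_mul]
    congr 1
    ring
  change (cechD x ℓ w) ⟨Finset.univ, hT⟩ * _ = (s • c.1 ⟨Finset.univ, hcard⟩) * _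
  have hD : (cechD x ℓ w) ⟨Finset.univ, hT⟩ = ∑ j : Fin (ℓ + 1),
      cechRes x (Finset.erase_subset j Finset.univ)
        (IsLocalization.mk' (CechLoc x (Finset.univ.erase j)) (a j * α)
          (⟨(∏ i ∈ Finset.univ.erase j, x i) ^ (n + N), pow_mem (Submonoid.mem_powers _) _⟩ :
            Submonoid.powers (∏ i ∈ Finset.univ.erase j, x i))) := by
    rw [cechD, LinearMap.pi_apply, LinearMap.sum_apply]
    refine Fintype.sum_equiv (Equiv.subtypeUnivEquiv fun j => Finset.mem_univ j) _ _ fun j => ?_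
    rcases j with ⟨j, hj⟩
    have hcompl : (Finset.univ.erase j)ᶜ = {j} := by
      ext i
      simp
    simp only [LinearMap.smul_apply, LinearMap.comp_apply, LinearMap.proj_apply, w]
    rw [hcompl, Finset.sum_singleton, map_smul, smul_smul, ← pow_add, ← two_mul, pow_mul,
      neg_one_sq, one_pow, one_smul]
    rfl
  rw [hD, Finset.sum_mul, Finset.sum_congr rfl fun j _ => hres j, ← map_sum, ← Finset.sum_mul, ha,
    Algebra.smul_def, pow_add, mul_mul_mul_comm, mul_assoc, ← map_pow, ← map_pow]
  rw [mul_left_comm, ← mul_assoc _ (c.1 _) _, mul_comm _ (c.1 _)]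
  rw [map_mul, map_mul, map_pow, ← hcα]
  simp only [map_pow]
  ring

/-! ### Unique factorization domains of dimension two -/

section Dimension

variable {B : Type*} [CommRing B] [IsDomain B] [UniqueFactorizationMonoid B]

/-- In a two-dimensional factorial domain, the primes containing two coprime elements are
maximal. -/
theorem isMaximal_of_isRelPrime_mem (hdim : ringKrullDim B ≤ 2) {u v : B} (huv : IsRelPrime u v)
    {Q : Ideal B} [Q.IsPrime] (hu : u ∈ Q) (hv : v ∈ Q) : Q.IsMaximal := by
  wlog hu0 : u ≠ 0 generalizing u v
  · refine this huv.symm hv hu ?_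
    rintro rfl
    rw [not_not.mp hu0] at huv
    exact not_isUnit_zero (huv dvd_rfl dvd_rfl)
  have hunit : ¬ IsUnit u := fun h => Ideal.IsPrime.ne_top ‹_› (Q.eq_top_of_isUnit_mem hu h)
  obtain ⟨q, hq, hqu, hqQ⟩ : ∃ q, Prime q ∧ q ∣ u ∧ q ∈ Q := by
    obtain ⟨s, hs, hsu⟩ := UniqueFactorizationMonoid.exists_prime_factors u hu0
    have hsQ : s.prod ∈ Q := Q.mem_of_dvd hsu.symm.dvd hu
    obtain ⟨q, hqs, hqQ⟩ := (Ideal.IsPrime.multiset_prod_mem_iff_exists_mem ‹_› s).mp hsQ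
    exact ⟨q, hs q hqs, (Multiset.dvd_prod hqs).trans hsu.dvd, hqQ⟩
  obtain ⟨M, hM, hQM⟩ := Q.exists_le_maximal (Ideal.IsPrime.ne_top ‹_›)
  -- Otherwise `0 < (q) < Q < M` is a chain of primes too long for dimension two; `(q) ≠ Q` because
  -- `q` divides `u` and cannot divide `v`.
  suffices Q = M by rwa [this]
  by_contra hne
  have hqprime : (Ideal.span {q}).IsPrime := (Ideal.span_singleton_prime hq.ne_zero).mpr hq
  have h1 : (⊥ : Ideal B) < Ideal.span {q} :=
    bot_lt_iff_ne_bot.mpr fun h => hq.ne_zero (Ideal.span_singleton_eq_bot.mp h)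
  have h2 : Ideal.span {q} < Q := by
    refine lt_of_le_of_ne ((Ideal.span_singleton_le_iff_mem Q).mpr hqQ) fun h => ?_
    exact hq.not_isUnit (huv hqu (Ideal.mem_span_singleton.mp (h ▸ hv)))
  have h3 : Q < M := lt_of_le_of_ne hQM hne
  have hM3 : (3 : ℕ∞) ≤ M.height := by
    have e1 := Ideal.height_add_one_le_of_lt_of_isPrime h1
    have e2 := Ideal.height_add_one_le_of_lt_of_isPrime h2
    have e3 := Ideal.height_add_one_le_of_lt_of_isPrime h3
    calc (3 : ℕ∞) = (⊥ : Ideal B).height + 1 + 1 + 1 := by rw [Ideal.height_bot]; rfl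
      _ ≤ M.height := by
        refine le_trans ?_ e3
        gcongr
        refine le_trans ?_ e2
        gcongr
  have hM2 : (M.height : WithBot ℕ∞) ≤ 2 := Ideal.height_le_ringKrullDim_of_isPrime.trans hdim
  have : ((3 : ℕ∞) : WithBot ℕ∞) ≤ ((2 : ℕ∞) : WithBot ℕ∞) :=
    (WithBot.coe_le_coe.mpr hM3).trans hM2
  rw [WithBot.coe_le_coe] at this
  exact absurd this (by decide)

/-- Two coprime elements of a two-dimensional factorial domain have no common zero off `x = 0`, up
to inverting an element `1 - x * t`. -/
theorem exists_pow_mul_one_sub_mem_span_pair (hdim : ringKrullDim B ≤ 2) {u v : B}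
    (huv : IsRelPrime u v) (x : B) :
    ∃ (j : ℕ) (t : B), x ^ j * (1 - x * t) ∈ Ideal.span {u, v} := by
  by_contra! hcon
  -- A prime containing `u, v` and avoiding `S` is maximal and omits `x`, so an inverse `t` of `x`
  -- modulo it puts `1 - x * t` in it, a contradiction.
  let S : Submonoid B :=
    { carrier := {b | ∃ (j : ℕ) (t : B), b = x ^ j * (1 - x * t)}
      one_mem' := ⟨0, 0, by simp⟩
      mul_mem' := by
        rintro _ _ ⟨i, t, rfl⟩ ⟨j, t', rfl⟩
        exact ⟨i + j, t + t' - x * t * t', by ring⟩ }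
  have hdisj : Disjoint (Ideal.span {u, v} : Set B) S := by
    rw [Set.disjoint_left]
    rintro _ h ⟨j, t, rfl⟩
    exact hcon j t h
  obtain ⟨P, hP, hle, hPS⟩ := Ideal.exists_le_prime_disjoint _ S hdisj
  have hmax : P.IsMaximal := isMaximal_of_isRelPrime_mem hdim huv
    (hle (Ideal.subset_span (by simp))) (hle (Ideal.subset_span (by simp)))
  have hxP : x ∉ P := fun h => Set.disjoint_left.mp hPS h ⟨1, 0, by simp⟩
  obtain ⟨t, i, hi, ht⟩ := hmax.exists_inv hxP
  refine Set.disjoint_left.mp hPS hi ⟨0, t, ?_⟩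
  rw [pow_zero, one_mul, ← ht]
  ring

end Dimension

end NonNoethCM

namespace NonNoethCM

/-! ### Rings of the form `k + x B` -/

/-- The injective algebra map `φ : A → B` identifies `A` with the subring `k + x B` of `B`. -/
structure IsConstAddMul {k A B : Type*} [Field k] [CommRing A] [Algebra k A] [CommRing B]
    [Algebra k B] (φ : A →ₐ[k] B) (x : B) : Prop where
  injective : Function.Injective φ
  mem_range_iff : ∀ b, b ∈ φ.range ↔ ∃ (c : k) (t : B), b = algebraMap k B c + x * t

namespace IsConstAddMul

variable {k A B : Type*} [Field k] [CommRing A] [Algebra k A] [CommRing B] [Algebra k B]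
  {φ : A →ₐ[k] B} {x : B}

theorem exists_eq_mul (hφ : IsConstAddMul φ x) (t : B) : ∃ a, φ a = x * t :=
  (hφ.mem_range_iff _).mpr ⟨0, t, by simp⟩

theorem exists_eq_one_sub (hφ : IsConstAddMul φ x) (t : B) : ∃ a, φ a = 1 - x * t :=
  (hφ.mem_range_iff _).mpr ⟨1, -t, by rw [map_one]; ring⟩

theorem exists_eq_add (hφ : IsConstAddMul φ x) (a : A) :
    ∃ (c : k) (t : B), φ a = algebraMap k B c + x * t :=
  (hφ.mem_range_iff _).mp ⟨a, rfl⟩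

/-- If `x` does not divide `φ f`, then `φ f` is invertible modulo `x`, so that quotients by `φ f` of
elements of `A` lie in `A`. -/
theorem exists_eq_of_mul_eq (hφ : IsConstAddMul φ x) {f a : A} {t : B} (hf : ¬ x ∣ φ f)
    (h : φ a = φ f * t) : ∃ b, φ b = t := by
  obtain ⟨c, f', hf'⟩ := hφ.exists_eq_add f
  obtain ⟨d, a', ha'⟩ := hφ.exists_eq_add a
  have hc : c ≠ 0 := by
    rintro rfl
    exact hf ⟨f', by simpa using hf'⟩
  -- Solve `d + x a' = (c + x f') t` for the term `c t`.
  refine (hφ.mem_range_iff t).mpr ⟨c⁻¹ * d, algebraMap k B c⁻¹ * (a' - f' * t), ?_⟩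
  have h1 : algebraMap k B c⁻¹ * algebraMap k B c = 1 := by
    rw [← map_mul, inv_mul_cancel₀ hc, map_one]
  rw [hf', ha'] at h
  rw [map_mul]
  linear_combination (-t) * h1 - algebraMap k B c⁻¹ * h

theorem eq_zero_of_algebraMap_mem {I : Ideal B} (hI : I ≠ ⊤) {c : k} (h : algebraMap k B c ∈ I) :
    c = 0 := by
  by_contra hc
  exact hI (I.eq_top_of_isUnit_mem h ((isUnit_iff_ne_zero.mpr hc).map (algebraMap k B)))

/-- Every element of `k + x B` divisible by `y` is divisible by `x`. -/
theorem dvd_of_dvd {y : B} (hφ : IsConstAddMul φ x) (hxy : Ideal.span {x, y} ≠ ⊤) {a : A}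
    (h : y ∣ φ a) : x ∣ φ a := by
  obtain ⟨c, t, ha⟩ := hφ.exists_eq_add a
  have hc : c = 0 := by
    refine eq_zero_of_algebraMap_mem hxy ?_
    rw [← add_sub_cancel_right (algebraMap k B c) (x * t), ← ha]
    exact sub_mem (Ideal.mem_of_dvd _ h (Ideal.subset_span (by simp)))
      (Ideal.mul_mem_right _ _ (Ideal.subset_span (by simp)))
  rw [ha, hc, map_zero, zero_add]
  exact dvd_mul_right x t

theorem comap_lt_comap {y : B} (hφ : IsConstAddMul φ x) (hyx : ¬ y ∣ x)
    (hxy : Ideal.span {x, y} ≠ ⊤) :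
    (Ideal.span {y}).comap φ < (Ideal.span {x}).comap φ := by
  refine lt_of_le_of_ne (fun a ha => ?_) fun h => ?_
  · rw [Ideal.mem_comap, Ideal.mem_span_singleton] at ha ⊢
    exact hφ.dvd_of_dvd hxy ha
  · obtain ⟨a, ha⟩ := hφ.exists_eq_mul 1
    have : a ∈ (Ideal.span {y}).comap φ := by
      rw [h, Ideal.mem_comap, Ideal.mem_span_singleton, ha]
      exact dvd_mul_right x 1
    rw [Ideal.mem_comap, Ideal.mem_span_singleton, ha, mul_one] at this
    exact hyx this

section Plane

variable [IsDomain B] {y : B}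

theorem isDomain (hφ : IsConstAddMul φ x) : IsDomain A :=
  hφ.injective.isDomain φ.toRingHom

theorem notMem_range (hφ : IsConstAddMul φ x) (hx : Prime x) (hy : Prime y) (hyx : ¬ y ∣ x)
    (hxy : Ideal.span {x, y} ≠ ⊤) (a : A) : φ a ≠ y := by
  intro h
  have := hφ.dvd_of_dvd hxy (a := a) (y := y) (h ▸ dvd_rfl)
  rw [h] at this
  exact hyx (hx.dvd_prime_iff_associated hy |>.mp this).symm.dvd

theorem two_le_height (hφ : IsConstAddMul φ x) (hx : Prime x) (hy : Prime y) (hyx : ¬ y ∣ x)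
    (hxy : Ideal.span {x, y} ≠ ⊤) : 2 ≤ ((Ideal.span {x}).comap φ).height := by
  have := hφ.isDomain
  have : (Ideal.span {x}).IsPrime := (Ideal.span_singleton_prime hx.ne_zero).mpr hx
  have : (Ideal.span {y}).IsPrime := (Ideal.span_singleton_prime hy.ne_zero).mpr hy
  have h0 : (⊥ : Ideal A) < (Ideal.span {y}).comap φ := by
    refine bot_lt_iff_ne_bot.mpr fun h => ?_
    obtain ⟨a, ha⟩ := hφ.exists_eq_mul y
    have hmem : a ∈ (Ideal.span {y}).comap φ := by
      rw [Ideal.mem_comap, Ideal.mem_span_singleton, ha]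
      exact dvd_mul_left y x
    rw [h, Ideal.mem_bot] at hmem
    rw [hmem, map_zero] at ha
    exact mul_ne_zero hx.ne_zero hy.ne_zero ha.symm
  have e1 := Ideal.height_add_one_le_of_lt_of_isPrime h0
  have e2 := Ideal.height_add_one_le_of_lt_of_isPrime (hφ.comap_lt_comap hyx hxy)
  rw [Ideal.height_bot, zero_add] at e1
  calc (2 : ℕ∞) = 1 + 1 := by rfl
    _ ≤ _ := by gcongr
    _ ≤ _ := e2

end Plane

end IsConstAddMul

/-! ### Grade at most one -/

theorem classicalGrade_congr {R : Type*} [CommRing R] (I : Ideal R) {M N : Type*} [AddCommGroup M]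
    [Module R M] [AddCommGroup N] [Module R N] (e : M ≃ₗ[R] N) :
    classicalGrade I M = classicalGrade I N := by
  simp only [classicalGrade, e.isWeaklyRegular_congr]

/-- An ideal `I` of a domain `S ⊆ T` which is stable under multiplication by some `y ∈ T` outside
`S` has grade at most one. -/
theorem classicalGrade_le_one {S T : Type*} [CommRing S] [IsDomain S] [CommRing T] [IsDomain T]
    (ψ : S →+* T) (hψ : Function.Injective ψ) (I : Ideal S) (y : T) (hy : ∀ s, ψ s ≠ y)
    (hI : ∀ i ∈ I, ∃ j, ψ j = y * ψ i) : classicalGrade I S ≤ 1 := by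
  refine iSup₂_le fun rs hrs => ?_
  match rs, hrs with
  | [], _ => simp
  | [r], _ => simp
  | r :: s :: rs, ⟨hreg, hmem⟩ =>
    exfalso
    rw [RingTheory.Sequence.isWeaklyRegular_cons_iff,
      RingTheory.Sequence.isWeaklyRegular_cons_iff] at hreg
    obtain ⟨hr, hs, -⟩ := hreg
    have hr0 : r ≠ 0 := by
      rintro rfl
      exact one_ne_zero (hr (by simp : (0 : S) • (1 : S) = (0 : S) • (0 : S)))
    obtain ⟨r', hr'⟩ := hI r (hmem r (by simp))
    obtain ⟨s', hs'⟩ := hI s (hmem s (by simp))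
    -- Here `r' = y r` and `s' = y s`. Regularity of `s` modulo `r` forces `y r ∈ r S`, hence `y ∈
    -- S`.
    have hmul : s * r' = r * s' := by
      apply hψ
      rw [map_mul, map_mul, hr', hs']
      ring
    have h1 := (isSMulRegular_quotient_iff_mem_of_smul_mem _ s).mp hs r'
      ((Submodule.mem_smul_pointwise_iff_exists _ _ _).mpr ⟨s', trivial, hmul.symm⟩)
    obtain ⟨c, -, hc⟩ := (Submodule.mem_smul_pointwise_iff_exists _ _ _).mp h1
    refine hy c (mul_left_cancel₀ ((map_ne_zero_iff ψ hψ).mpr hr0) ?_)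
    rw [← map_mul, mul_comm _ y, ← hr', ← hc, smul_eq_mul]

/-- The hypotheses of `classicalGrade_le_one` survive adjoining variables: the extended ideal is
stable under the constant `y`, and a preimage of that constant would have a constant coefficient
mapping to `y`. -/
theorem polynomialGrade_le_one {S T : Type*} [CommRing S] [IsDomain S] [CommRing T] [IsDomain T]
    (ψ : S →+* T) (hψ : Function.Injective ψ) (I : Ideal S) (y : T) (hy : ∀ s, ψ s ≠ y)
    (hI : ∀ i ∈ I, ∃ j, ψ j = y * ψ i) : polynomialGrade I S ≤ 1 := by
  refine iSup_le fun m => ?_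
  rw [classicalGradeExt, classicalGrade_congr _
    (TensorProduct.AlgebraTensorModule.rid S (MvPolynomial (Fin m) S) (MvPolynomial (Fin m) S))]
  refine classicalGrade_le_one (MvPolynomial.map ψ) (MvPolynomial.map_injective ψ hψ) _
    (MvPolynomial.C y) (fun s h => hy (s.coeff 0) ?_) fun i hi => ?_
  · rw [← MvPolynomial.coeff_map, h, MvPolynomial.coeff_zero_C]
  · induction hi using Submodule.span_induction with
    | mem _ h =>
      obtain ⟨i, hi, rfl⟩ := h
      obtain ⟨j, hj⟩ := hI i hi
      exact ⟨MvPolynomial.C j, by simp [MvPolynomial.algebraMap_eq, hj]⟩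
    | zero => exact ⟨0, by simp⟩
    | add p q _ _ hp hq =>
      obtain ⟨p', hp⟩ := hp
      obtain ⟨q', hq⟩ := hq
      exact ⟨p' + q', by rw [map_add, map_add, hp, hq, mul_add]⟩
    | smul a p _ hp =>
      obtain ⟨p', hp⟩ := hp
      exact ⟨a * p', by rw [map_mul, hp, smul_eq_mul, map_mul, mul_left_comm]⟩

/-! ### Failure of the grade and unmixedness conditions for `k + x B` -/

namespace IsConstAddMul

section Plane

variable {k A B : Type*} [Field k] [CommRing A] [Algebra k A] [CommRing B] [Algebra k B]
  {φ : A →ₐ[k] B} {x y : B} [IsDomain B]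

theorem not_isCohenMacaulayIdeals (hφ : IsConstAddMul φ x) (hx : Prime x) (hy : Prime y)
    (hyx : ¬ y ∣ x) (hxy : Ideal.span {x, y} ≠ ⊤) : ¬ IsCohenMacaulayIdeals A := by
  intro h
  have := hφ.isDomain
  have h1 : polynomialGrade ((Ideal.span {x}).comap φ) A ≤ 1 := by
    refine polynomialGrade_le_one φ.toRingHom hφ.injective _ y (hφ.notMem_range hx hy hyx hxy)
      fun i hi => ?_
    obtain ⟨t, ht⟩ := Ideal.mem_span_singleton.mp (Ideal.mem_comap.mp hi)
    obtain ⟨j, hj⟩ := hφ.exists_eq_mul (y * t)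
    refine ⟨j, hj.trans ?_⟩
    change _ = y * φ i
    rw [ht, mul_left_comm]
  exact absurd ((hφ.two_le_height hx hy hyx hxy).trans ((h _).le.trans h1)) (by decide)

/-- The principal ideal of `xy` is the counterexample: `r · xy² ∈ xy A` means `r y ∈ A`, that is, `x
∣ r`. Hence `m` is weakly associated, but `yB ∩ A` lies strictly between `(xy)` and `m`. -/
theorem not_isWeakBourbakiUnmixed (hφ : IsConstAddMul φ x) (hx : Prime x) (hy : Prime y)
    (hyx : ¬ y ∣ x) (hxy : Ideal.span {x, y} ≠ ⊤) : ¬ IsWeakBourbakiUnmixed A := by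
  intro h
  have := hφ.isDomain
  have : (Ideal.span {x}).IsPrime := (Ideal.span_singleton_prime hx.ne_zero).mpr hx
  have : (Ideal.span {y}).IsPrime := (Ideal.span_singleton_prime hy.ne_zero).mpr hy
  obtain ⟨a, ha⟩ := hφ.exists_eq_mul y
  obtain ⟨b, hb⟩ := hφ.exists_eq_mul (y * y)
  have ha0 : a ≠ 0 := by
    rintro rfl
    rw [map_zero] at ha
    exact mul_ne_zero hx.ne_zero hy.ne_zero ha.symm
  have hI := h (Ideal.span {a}) ⟨{a}, by simp⟩ (by
    rw [Submodule.spanFinrank_singleton ha0]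
    exact Ideal.one_le_height_span_singleton_of_mem_nonZeroDivisors
      (mem_nonZeroDivisors_of_ne_zero ha0))
  have htors : Ideal.torsionOf A (A ⧸ Ideal.span {a}) (Ideal.Quotient.mk _ b) =
      (Ideal.span {x}).comap φ := by
    ext r
    rw [Ideal.mem_torsionOf_iff, Ideal.mem_comap, Ideal.mem_span_singleton, ← Ideal.Quotient.mk_eq_mk,
      ← Submodule.Quotient.mk_smul, Submodule.Quotient.mk_eq_zero, Ideal.mem_span_singleton,
      smul_eq_mul]
    constructor
    · rintro ⟨s, hs⟩
      by_contra hxr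
      obtain ⟨c, hc⟩ := hφ.exists_eq_of_mul_eq (f := r) (a := s) (t := y) hxr (by
        refine mul_left_cancel₀ (mul_ne_zero hx.ne_zero hy.ne_zero) ?_
        rw [← ha, ← map_mul, ← hs, map_mul, hb, ha]
        ring)
      exact hφ.notMem_range hx hy hyx hxy c hc
    · rintro ⟨t, ht⟩
      obtain ⟨s, hs⟩ := hφ.exists_eq_mul (y * t)
      refine ⟨s, hφ.injective ?_⟩
      rw [map_mul, map_mul, ha, hb, hs, ht]
      ring
  have hm : (Ideal.span {x}).comap φ ∈ weaklyAssociatedPrimes A (A ⧸ Ideal.span {a}) :=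
    ⟨Ideal.Quotient.mk _ b, by rw [htors, Ideal.minimalPrimes_eq_subsingleton_self]; rfl⟩
  rw [hI] at hm
  have hlt := hφ.comap_lt_comap hyx hxy
  refine hlt.not_ge (hm.2 ⟨inferInstance, ?_⟩ hlt.le)
  rw [Ideal.span_singleton_le_iff_mem, Ideal.mem_comap, ha]
  exact Ideal.mul_mem_left _ _ (Ideal.mem_span_singleton_self y)

end Plane

end IsConstAddMul

end NonNoethCM

namespace NonNoethCM

/-! ### Primes at which the top Čech cohomology of `k + x B` vanishes -/

theorem subsingleton_cech_one {R : Type*} [CommRing R] (y : Fin 1 → R) (p : Ideal R) [p.IsPrime]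
    (h : y 0 = 0) : Subsingleton (LocalizedModule p.primeCompl (CechCohomology y 1)) :=
  subsingleton_localizedModule_cechCohomology y p fun n =>
    ⟨1, 1, fun h1 => Ideal.IsPrime.ne_top ‹_› (p.eq_top_of_isUnit_mem h1 isUnit_one), by simp [h]⟩

theorem subsingleton_cech_two {R : Type*} [CommRing R] (y : Fin 2 → R) (p : Ideal R) [p.IsPrime]
    (h : y 0 ≠ 0 → y 1 ≠ 0 → ∀ n : ℕ, ∃ N : ℕ, ∃ s ∉ p, ∃ a b,
      s * (y 0 * y 1) ^ N = a * y 0 ^ (n + N) + b * y 1 ^ (n + N)) :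
    Subsingleton (LocalizedModule p.primeCompl (CechCohomology y 2)) := by
  refine subsingleton_localizedModule_cechCohomology y p fun n => ?_
  rw [Fin.prod_univ_two]
  by_cases h0 : y 0 * y 1 = 0
  · exact ⟨1, 1, fun h1 => Ideal.IsPrime.ne_top ‹_› (p.eq_top_of_isUnit_mem h1 isUnit_one),
      by simp [h0]⟩
  · obtain ⟨N, s, hs, a, b, hab⟩ := h (left_ne_zero_of_mul h0) (right_ne_zero_of_mul h0) n
    refine ⟨N, s, hs, Ideal.mem_span_range_iff_exists_fun.mpr ⟨![a, b], ?_⟩⟩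
    rw [hab, Fin.sum_univ_two]
    rfl

theorem subsingleton_cech_three {R : Type*} [CommRing R] (y : Fin 3 → R) (p : Ideal R) [p.IsPrime]
    (h : ∀ n : ℕ, ∃ N : ℕ, ∃ s ∉ p, ∃ a b,
      s * (y 0 * y 1 * y 2) ^ N = a * y 0 ^ (n + N) + b * y 1 ^ (n + N)) :
    Subsingleton (LocalizedModule p.primeCompl (CechCohomology y 3)) := by
  refine subsingleton_localizedModule_cechCohomology y p fun n => ?_
  rw [Fin.prod_univ_three]
  obtain ⟨N, s, hs, a, b, hab⟩ := h n
  refine ⟨N, s, hs, Ideal.mem_span_range_iff_exists_fun.mpr ⟨![a, b, 0], ?_⟩⟩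
  rw [hab, Fin.sum_univ_three]
  simp

namespace IsConstAddMul

section Vanishing

variable {k A B : Type*} [Field k] [CommRing A] [Algebra k A] [CommRing B] [Algebra k B]
  [IsDomain B] [UniqueFactorizationMonoid B] {φ : A →ₐ[k] B} {x : B}

/-- Two elements of `k + x B` which are both divisible by `x` have vanishing second Čech cohomology
at the prime `x B`. -/
theorem subsingleton_cech_of_dvd (hφ : IsConstAddMul φ x) (hx : Prime x)
    (hdim : ringKrullDim B ≤ 2) (y : Fin 2 → A) (h0 : x ∣ φ (y 0)) (h1 : x ∣ φ (y 1))
    [((Ideal.span {x}).comap φ).IsPrime] :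
    Subsingleton (LocalizedModule ((Ideal.span {x}).comap φ).primeCompl (CechCohomology y 2)) := by
  refine subsingleton_cech_two y _ fun hy0 _ n => ?_
  obtain ⟨f, hf⟩ := h0
  obtain ⟨g, hg⟩ := h1
  have hf0 : f ≠ 0 := by
    rintro rfl
    rw [mul_zero] at hf
    exact hy0 (hφ.injective (hf.trans (map_zero φ).symm))
  obtain ⟨f, g, d, hfg, rfl, rfl⟩ := UniqueFactorizationMonoid.exists_reduced_factors f hf0 g
  obtain ⟨j, t, hjt⟩ :=
    exists_pow_mul_one_sub_mem_span_pair hdim (hfg.pow (m := n) (n := n)) x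
  obtain ⟨α, β, hαβ⟩ := Ideal.mem_span_pair.mp hjt
  obtain ⟨s, hs⟩ := hφ.exists_eq_one_sub t
  obtain ⟨a, ha⟩ := hφ.exists_eq_mul (d ^ (j + 1) * g ^ (n + j + 1) * α)
  obtain ⟨b, hb⟩ := hφ.exists_eq_mul (d ^ (j + 1) * f ^ (n + j + 1) * β)
  -- With `N = n + j + 1`, `2N` exceeds `n + N` by `j + 1`: of the spare factors `x`, `j` are used
  -- by the relation for `x^j (1 - x t)` and one brings the coefficients into `A`.
  refine ⟨n + j + 1, s, fun h => ?_, a, b, hφ.injective ?_⟩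
  · rw [Ideal.mem_comap, Ideal.mem_span_singleton, hs] at h
    exact hx.not_isUnit (isUnit_of_dvd_one ((dvd_sub_left (dvd_mul_right x t)).mp h))
  · simp only [map_mul, map_add, map_pow, ha, hb, hs, hf, hg]
    linear_combination
      -(x ^ (n + (n + j + 1) + 1) * d ^ (2 * (n + j + 1)) * (f * g) ^ (n + j + 1)) * hαβ

/-- Two elements of `k + x B`, the second of which has a prime factor `q` in `B` not dividing `x`,
have vanishing second Čech cohomology at the prime below `q`. -/
theorem subsingleton_cech_of_prime_dvd (hφ : IsConstAddMul φ x) {q : B} (hq : Prime q)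
    (hqx : ¬ q ∣ x) (y : Fin 2 → A) (h1 : q ∣ φ (y 1))
    [((Ideal.span {q}).comap φ).IsPrime] :
    Subsingleton (LocalizedModule ((Ideal.span {q}).comap φ).primeCompl (CechCohomology y 2)) := by
  refine subsingleton_cech_two y _ fun hy0 hy1 n => ?_
  obtain ⟨a, u, hu, hau⟩ := WfDvdMonoid.max_power_factor
    ((map_ne_zero_iff φ hφ.injective).mpr hy0) hq.irreducible
  obtain ⟨b, v, hv, hbv⟩ := WfDvdMonoid.max_power_factor
    ((map_ne_zero_iff φ hφ.injective).mpr hy1) hq.irreducible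
  have hb : b ≠ 0 := by
    rintro rfl
    rw [pow_zero, one_mul] at hbv
    exact hv (hbv ▸ h1)
  -- Take `N = a n`. Since `b ≥ 1`, the second element to the power `N` contains `q^(a n)`, which
  -- together with `u^n` supplies the missing `n`-th power of `q^a u`.
  obtain ⟨e, he⟩ : ∃ e, b * (a * n) = a * n + e :=
    Nat.exists_eq_add_of_le (Nat.le_mul_of_pos_left _ (Nat.pos_of_ne_zero hb))
  obtain ⟨s, hs⟩ := hφ.exists_eq_mul (u ^ n)
  obtain ⟨c, hc⟩ := hφ.exists_eq_mul (q ^ e * v ^ (a * n))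
  refine ⟨a * n, s, fun h => ?_, c, 0, hφ.injective ?_⟩
  · rw [Ideal.mem_comap, Ideal.mem_span_singleton, hs] at h
    rcases hq.dvd_or_dvd h with h | h
    · exact hqx h
    · exact hu (hq.dvd_of_dvd_pow h)
  · rw [zero_mul, add_zero]
    simp only [map_mul, map_pow, hc, hs, hau, hbv]
    rw [mul_pow (q ^ a * u), mul_pow (q ^ b), ← pow_mul q b, he]
    ring

/-- Three elements of `k + x B`, the first two of which are coprime in `B`, have vanishing third Čech
cohomology at every prime lying below a prime of `B` not containing `x`. -/
theorem subsingleton_cech_of_isRelPrime (hφ : IsConstAddMul φ x) (hdim : ringKrullDim B ≤ 2)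
    (y : Fin 3 → A) (hy : IsRelPrime (φ (y 0)) (φ (y 1))) (Q : Ideal B) [Q.IsPrime] (hxQ : x ∉ Q)
    (h2 : φ (y 2) ∈ Q) [(Q.comap φ).IsPrime] :
    Subsingleton (LocalizedModule (Q.comap φ).primeCompl (CechCohomology y 3)) := by
  refine subsingleton_cech_three y _ fun n => ?_
  -- If not, some prime `P ≤ Q` contains the two powers but not `φ (y 2)`; coprimality makes `P`
  -- maximal, so `P = Q`, which contains `φ (y 2)`.
  obtain ⟨s, hs, N, α, β, h⟩ : ∃ s ∉ Q, ∃ N : ℕ, ∃ α β,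
      s * φ (y 2) ^ N = α * φ (y 0) ^ n + β * φ (y 1) ^ n := by
    by_contra! hcon
    have hdisj : Disjoint (Ideal.span {φ (y 0) ^ n, φ (y 1) ^ n} : Set B)
        (Q.primeCompl ⊔ Submonoid.powers (φ (y 2)) : Submonoid B) := by
      rw [Set.disjoint_left]
      rintro _ h hm
      obtain ⟨s, hs, _, ⟨N, rfl⟩, rfl⟩ := Submonoid.mem_sup.mp hm
      obtain ⟨α, β, hαβ⟩ := Ideal.mem_span_pair.mp h
      exact hcon s hs N α β hαβ.symm
    obtain ⟨P, hP, hle, hPS⟩ := Ideal.exists_le_prime_disjoint _ _ hdisj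
    have hmax : P.IsMaximal := isMaximal_of_isRelPrime_mem hdim (hy.pow (m := n) (n := n))
      (hle (Ideal.subset_span (by simp))) (hle (Ideal.subset_span (by simp)))
    have hPQ : P ≤ Q := fun b hb => by
      by_contra hbQ
      exact Set.disjoint_left.mp hPS hb (Submonoid.mem_sup_left hbQ)
    rw [← hmax.eq_of_le (Ideal.IsPrime.ne_top ‹_›) hPQ] at h2
    exact Set.disjoint_left.mp hPS h2 (Submonoid.mem_sup_right (Submonoid.mem_powers _))
  -- Multiplying the relation by `x ∉ Q` brings it from `B` into `A`.
  obtain ⟨s', hs'⟩ := hφ.exists_eq_mul s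
  obtain ⟨a, ha⟩ := hφ.exists_eq_mul (α * φ (y 1) ^ N)
  obtain ⟨b, hb⟩ := hφ.exists_eq_mul (β * φ (y 0) ^ N)
  refine ⟨N, s', fun hmem => ?_, a, b, hφ.injective ?_⟩
  · rw [Ideal.mem_comap, hs'] at hmem
    exact ((inferInstance : Q.IsPrime).mem_or_mem hmem).elim hxQ hs
  · simp only [map_mul, map_add, map_pow, ha, hb, hs']
    linear_combination (x * (φ (y 0) * φ (y 1)) ^ N) * h

end Vanishing

/-- Every prime of `k + x B` other than `x B` is contained in the contraction of a prime of `B`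
avoiding `x`. -/
theorem exists_isPrime_le_comap {k A B : Type*} [Field k] [CommRing A] [Algebra k A] [CommRing B]
    [Algebra k B] {φ : A →ₐ[k] B} {x : B} (hφ : IsConstAddMul φ x) (p : Ideal A) [p.IsPrime]
    (hp : ¬ (Ideal.span {x}).comap φ ≤ p) :
    ∃ Q : Ideal B, Q.IsPrime ∧ x ∉ Q ∧ p ≤ Q.comap φ := by
  have hdisj : Disjoint (p.map φ : Set B) (Submonoid.powers x) := by
    rw [Set.disjoint_left]
    rintro _ hm ⟨n, rfl⟩
    -- That is, `x · pB ⊆ p`; the free factor `c` makes the induction pass through scalars from `B`.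
    have key : ∀ b ∈ p.map φ, ∀ c, ∃ a ∈ p, φ a = x * (c * b) := by
      intro b hb
      induction hb using Submodule.span_induction with
      | mem _ h =>
        obtain ⟨a, ha, rfl⟩ := h
        intro c
        obtain ⟨e, he⟩ := hφ.exists_eq_mul c
        exact ⟨e * a, p.mul_mem_left e ha, by rw [map_mul, he, mul_assoc]⟩
      | zero => exact fun c => ⟨0, p.zero_mem, by simp⟩
      | add b b' _ _ hb hb' =>
        intro c
        obtain ⟨a, ha, h⟩ := hb c
        obtain ⟨a', ha', h'⟩ := hb' c
        exact ⟨a + a', p.add_mem ha ha', by rw [map_add, h, h']; ring⟩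
      | smul d b _ hb =>
        intro c
        obtain ⟨a, ha, h⟩ := hb (c * d)
        exact ⟨a, ha, by rw [h, smul_eq_mul, mul_assoc c]⟩
    obtain ⟨a, ha, h⟩ := key _ hm 1
    obtain ⟨e, he⟩ := hφ.exists_eq_mul 1
    have hep : e ∈ p := by
      refine Ideal.IsPrime.mem_of_pow_mem ‹_› (n + 1) ?_
      convert ha
      apply hφ.injective
      rw [map_pow, he, h]
      ring
    -- For `r = x t`, `t` need not lie in `A`, but `r² = x · (x t²)` has both factors in `A`.
    refine hp fun r hr => Ideal.IsPrime.mem_of_pow_mem ‹_› 2 ?_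
    obtain ⟨t, ht⟩ := Ideal.mem_span_singleton.mp (Ideal.mem_comap.mp hr)
    obtain ⟨e', he'⟩ := hφ.exists_eq_mul (t ^ 2)
    convert p.mul_mem_right e' hep
    apply hφ.injective
    rw [map_pow, map_mul, ht, he, he']
    ring
  obtain ⟨Q, hQ, hle, hdQ⟩ := Ideal.exists_le_prime_disjoint _ _ hdisj
  exact ⟨Q, hQ, fun h => Set.disjoint_left.mp hdQ h (Submonoid.mem_powers x),
    Ideal.map_le_iff_le_comap.mp hle⟩

/-! ### Strong parameter sequences on `k + x B` -/

section HamiltonMarley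

variable {k A B : Type*} [Field k] [CommRing A] [Algebra k A] [CommRing B] [Algebra k B]
  [IsDomain B] [UniqueFactorizationMonoid B] {φ : A →ₐ[k] B} {x : B}

/-- A common prime factor in `B` gives a prime of `A` over the sequence at which the top Čech
cohomology vanishes. -/
theorem isRelPrime_of_isParameterSequence (hφ : IsConstAddMul φ x) (hx : Prime x)
    (hdim : ringKrullDim B ≤ 2) {y : Fin 2 → A} (hy : IsParameterSequence y) (h0 : y 0 ≠ 0) :
    IsRelPrime (φ (y 0)) (φ (y 1)) := by
  rw [UniqueFactorizationMonoid.isRelPrime_iff_no_prime_factors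
    ((map_ne_zero_iff φ hφ.injective).mpr h0)]
  intro q hq0 hq1 hq
  have hle : ∀ b, b ∣ φ (y 0) → b ∣ φ (y 1) →
      Ideal.span (Set.range y) ≤ (Ideal.span {b}).comap φ := by
    intro b hb0 hb1
    rw [Ideal.span_le, Set.range_subset_iff, Fin.forall_fin_two]
    exact ⟨Ideal.mem_span_singleton.mpr hb0, Ideal.mem_span_singleton.mpr hb1⟩
  have hprime : ∀ b : B, Prime b → ((Ideal.span {b}).comap φ).IsPrime := fun b hb =>
    have := (Ideal.span_singleton_prime hb.ne_zero).mpr hb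
    inferInstance
  by_cases hqx : q ∣ x
  · have hxq := (hq.dvd_prime_iff_associated hx |>.mp hqx).symm.dvd
    have := hprime x hx
    exact not_subsingleton_iff_nontrivial.mpr
      (hy.cech_nontrivial _ (hle x (hxq.trans hq0) (hxq.trans hq1)))
      (hφ.subsingleton_cech_of_dvd hx hdim y (hxq.trans hq0) (hxq.trans hq1))
  · have := hprime q hq
    exact not_subsingleton_iff_nontrivial.mpr (hy.cech_nontrivial _ (hle q hq0 hq1))
      (hφ.subsingleton_cech_of_prime_dvd hq hqx y hq1)

theorem _root_.NonNoethCM.IsParameterSequence.ne_zero {R : Type*} [CommRing R] {y : Fin 1 → R}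
    (hy : IsParameterSequence y) : y 0 ≠ 0 := by
  intro h
  obtain ⟨p, hp, hle⟩ := Ideal.exists_le_maximal _ hy.ne_top
  exact not_subsingleton_iff_nontrivial.mpr (hy.cech_nontrivial p hle)
    (subsingleton_cech_one y p h)

theorem not_isParameterSequence_three (hφ : IsConstAddMul φ x) (hx : Prime x)
    (hdim : ringKrullDim B ≤ 2) {y : Fin 3 → A} (hy : IsRelPrime (φ (y 0)) (φ (y 1))) :
    ¬ IsParameterSequence y := by
  intro h
  obtain ⟨p, hp, hle⟩ := Ideal.exists_le_maximal _ h.ne_top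
  have hmem : ∀ i, y i ∈ p := fun i => hle (Ideal.subset_span ⟨i, rfl⟩)
  have hp' : ¬ (Ideal.span {x}).comap φ ≤ p := by
    intro hxp
    have : (Ideal.span {x}).IsPrime := (Ideal.span_singleton_prime hx.ne_zero).mpr hx
    -- This is maximality of `m`: if `m ≤ p`, the constant term of any element of `p` lies in `p`,
    -- hence is zero.
    have hmax : ((Ideal.span {x}).comap φ) = p := by
      refine le_antisymm hxp fun a ha => ?_
      obtain ⟨c, t, hat⟩ := hφ.exists_eq_add a
      have hxt : a - algebraMap k A c ∈ p := hxp (by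
        rw [Ideal.mem_comap, Ideal.mem_span_singleton, map_sub, AlgHom.commutes, hat,
          add_sub_cancel_left]
        exact dvd_mul_right x t)
      have hc : algebraMap k A c ∈ p := by
        have := p.sub_mem ha hxt
        rwa [sub_sub_cancel] at this
      rw [eq_zero_of_algebraMap_mem hp.ne_top hc, map_zero, zero_add] at hat
      rw [Ideal.mem_comap, Ideal.mem_span_singleton, hat]
      exact dvd_mul_right x t
    have hdvd : ∀ i, x ∣ φ (y i) := fun i => by
      rw [← Ideal.mem_span_singleton, ← Ideal.mem_comap, hmax]
      exact hmem i
    exact hx.not_isUnit (hy (hdvd 0) (hdvd 1))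
  obtain ⟨Q, hQ, hxQ, hpQ⟩ := hφ.exists_isPrime_le_comap p hp'
  exact not_subsingleton_iff_nontrivial.mpr (h.cech_nontrivial _ (hle.trans hpQ))
    (hφ.subsingleton_cech_of_isRelPrime hdim y hy Q hxQ (hpQ (hmem 2)))

/-- Two elements of `k + x B` which are coprime in `B` form a weakly regular sequence. -/
theorem isWeaklyRegular_pair (hφ : IsConstAddMul φ x) (hx : Prime x) {f g : A} (hf : f ≠ 0)
    (hfg : IsRelPrime (φ f) (φ g)) : RingTheory.Sequence.IsWeaklyRegular A [f, g] := by
  have := hφ.isDomain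
  have hf' := (map_ne_zero_iff φ hφ.injective).mpr hf
  rw [RingTheory.Sequence.isWeaklyRegular_cons_iff,
    RingTheory.Sequence.isWeaklyRegular_singleton_iff]
  refine ⟨fun a b h => mul_left_cancel₀ hf h, ?_⟩
  refine (isSMulRegular_quotient_iff_mem_of_smul_mem _ g).mpr fun a ha => ?_
  obtain ⟨b, -, hb⟩ := (Submodule.mem_smul_pointwise_iff_exists _ _ _).mp ha
  rw [smul_eq_mul, smul_eq_mul] at hb
  have hb' : φ f * φ b = φ g * φ a := by rw [← map_mul, hb, map_mul]
  obtain ⟨t, ht⟩ := hfg.dvd_of_dvd_mul_left ⟨φ b, hb'.symm⟩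
  obtain ⟨c, hc⟩ : ∃ c, φ c = t := by
    -- One of `f, g` is invertible modulo `x`, and `t` is a quotient by either: `a = f t` and `b = g
    -- t`.
    by_cases hxf : x ∣ φ f
    · refine hφ.exists_eq_of_mul_eq (f := g) (a := b) (fun hxg => hx.not_isUnit (hfg hxf hxg)) ?_
      refine mul_left_cancel₀ hf' ?_
      rw [hb', ht, mul_left_comm]
    · exact hφ.exists_eq_of_mul_eq hxf ht
  refine (Submodule.mem_smul_pointwise_iff_exists _ _ _).mpr ⟨c, trivial, hφ.injective ?_⟩
  rw [smul_eq_mul, map_mul, hc, ht]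

theorem isCohenMacaulayHM (hφ : IsConstAddMul φ x) (hx : Prime x) (hdim : ringKrullDim B ≤ 2) :
    IsCohenMacaulayHM A := by
  intro ℓ y hℓ hy
  have := hφ.isDomain
  refine ⟨?_, ?_⟩
  · have h0 := (hy 1 hℓ le_rfl).ne_zero
    match ℓ, y, hℓ, hy, h0 with
    | 1, y, _, hy, h0 =>
      rw [List.ofFn_succ, List.ofFn_zero, RingTheory.Sequence.isWeaklyRegular_singleton_iff]
      exact fun a b h => mul_left_cancel₀ h0 h
    | 2, y, _, hy, h0 =>
      have h01 := hφ.isRelPrime_of_isParameterSequence hx hdim (hy 2 le_rfl (by norm_num)) h0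
      exact hφ.isWeaklyRegular_pair hx h0 h01
    | ℓ + 3, y, _, hy, h0 =>
      have h01 := hφ.isRelPrime_of_isParameterSequence hx hdim (hy 2 (by omega) (by norm_num)) h0
      exact absurd (hy 3 (by omega) (by norm_num)) (hφ.not_isParameterSequence_three hx hdim h01)
  · rw [smul_eq_mul, Ideal.mul_top]
    refine fun h => (hy ℓ le_rfl hℓ).ne_top ?_
    rw [h, Ideal.ofList]
    congr 1
    ext a
    simp [List.mem_ofFn]

end HamiltonMarley

end IsConstAddMul

end NonNoethCM

namespace NonNoethCM

/-! ### The semigroup ring of `H` -/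

theorem mem_H {p : ℕ × ℕ} : p ∈ H ↔ p.1 ≠ 0 ∨ p = (0, 0) := Iff.rfl

theorem isNormalSubmonoid_HInt : IsNormalSubmonoid HInt := by
  rintro _ ⟨⟨a, b⟩, hc, rfl⟩ _ ⟨⟨a', b'⟩, hc', rfl⟩ n hn ⟨⟨a'', b''⟩, hc'', h⟩
  simp only [AddMonoidHom.coe_prodMap, Prod.map_apply, Nat.coe_castAddMonoidHom, Prod.mk_sub_mk,
    Prod.smul_mk, Prod.mk.injEq, nsmul_eq_mul] at h
  obtain ⟨h1, h2⟩ := h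
  have hn' : (0 : ℤ) < n := by exact_mod_cast hn
  have ha : (0 : ℤ) ≤ (a : ℤ) - a' := by
    by_contra! hlt
    nlinarith [mul_neg_of_pos_of_neg hn' hlt]
  have hb : (0 : ℤ) ≤ (b : ℤ) - b' := by
    by_contra! hlt
    nlinarith [mul_neg_of_pos_of_neg hn' hlt]
  -- Truncated subtraction is genuine here by `ha` and `hb`.
  refine ⟨(a - a', b - b'), ?_, ?_⟩
  · change _ ∈ H
    rw [mem_H]
    rcases mem_H.mp hc'' with h0 | h0
    · left
      have : a'' ≠ 0 := h0
      intro hz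
      have hz' : a - a' = 0 := hz
      have : (a : ℤ) - a' = 0 := by omega
      rw [this, mul_zero] at h1
      omega
    · right
      obtain ⟨rfl, rfl⟩ := Prod.mk.inj h0
      have e1 : (a : ℤ) - a' = 0 := by
        simpa [hn.ne'] using h1.symm
      have e2 : (b : ℤ) - b' = 0 := by
        simpa [hn.ne'] using h2.symm
      rw [Prod.mk.injEq]
      omega
  · simp only [AddMonoidHom.coe_prodMap, Prod.map_apply, Nat.coe_castAddMonoidHom, Prod.mk_sub_mk,
      Prod.mk.injEq]
    omega

/-- The exponent vector of a pair in `H`. -/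
noncomputable def exponentHom : H →+ (Fin 2 →₀ ℕ) where
  toFun h := Finsupp.single 0 h.1.1 + Finsupp.single 1 h.1.2
  map_zero' := by simp
  map_add' g h := by
    simp only [AddSubmonoid.coe_add, Prod.fst_add, Prod.snd_add, Finsupp.single_add]
    abel

theorem exponentHom_apply (h : H) :
    exponentHom h = Finsupp.single 0 h.1.1 + Finsupp.single 1 h.1.2 := rfl

theorem exponentHom_injective : Function.Injective exponentHom := by
  intro g h hgh
  have h0 := DFunLike.congr_fun hgh 0
  have h1 := DFunLike.congr_fun hgh 1
  simp [exponentHom_apply] at h0 h1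
  exact Subtype.ext (Prod.ext h0 h1)

variable (k : Type*) [Field k]

/-- The map `k[H] → k[x, y]`, `(a, b) ↦ x ^ a y ^ b`. -/
noncomputable def toPoly : AddMonoidAlgebra k H →ₐ[k] MvPolynomial (Fin 2) k :=
  AddMonoidAlgebra.mapDomainAlgHom k k exponentHom

theorem toPoly_single (h : H) (c : k) :
    toPoly k (AddMonoidAlgebra.single h c) =
      MvPolynomial.C c * (MvPolynomial.X 0 ^ h.1.1 * MvPolynomial.X 1 ^ h.1.2) := by
  have h1 : toPoly k (AddMonoidAlgebra.single h c) = MvPolynomial.monomial (exponentHom h) c :=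
    AddMonoidAlgebra.mapDomain_single
  rw [h1, MvPolynomial.monomial_eq, exponentHom_apply, Finsupp.prod_fintype _ _ (by simp),
    Fin.prod_univ_two]
  simp

theorem toPoly_injective : Function.Injective (toPoly k) :=
  AddMonoidAlgebra.mapDomain_injective exponentHom_injective

/-- Both sides are spanned by `1` and the monomials divisible by `x`, whose exponents are exactly
the elements of `H`. -/
theorem range_toPoly : (toPoly k).range = kAddXPoly k := by
  apply le_antisymm
  · rintro _ ⟨p, rfl⟩
    change toPoly k p ∈ kAddXPoly k
    induction p using AddMonoidAlgebra.induction_linear with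
    | zero => exact (map_zero (toPoly k)).symm ▸ zero_mem _
    | add p q hp hq => exact (map_add (toPoly k) p q).symm ▸ add_mem hp hq
    | single h c =>
      rw [toPoly_single]
      rcases h with ⟨⟨a, b⟩, h | h⟩
      · obtain ⟨a, rfl⟩ := Nat.exists_eq_succ_of_ne_zero (show a ≠ 0 from h)
        exact ⟨0, MvPolynomial.C c * (MvPolynomial.X 0 ^ a * MvPolynomial.X 1 ^ b), by
          rw [map_zero, zero_add, pow_succ]; ring⟩
      · obtain ⟨rfl, rfl⟩ := Prod.mk.inj h
        exact ⟨c, 0, by simp⟩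
  · rintro _ ⟨c, f, rfl⟩
    refine add_mem ((toPoly k).range.algebraMap_mem c) ?_
    induction f using MvPolynomial.induction_on' with
    | monomial s c =>
      refine ⟨AddMonoidAlgebra.single ⟨(s 0 + 1, s 1), Or.inl (Nat.succ_ne_zero _)⟩ c, ?_⟩
      change toPoly k _ = _
      rw [toPoly_single, MvPolynomial.monomial_eq, Finsupp.prod_fintype _ _ (by simp),
        Fin.prod_univ_two]
      ring
    | add p q hp hq => exact (mul_add (MvPolynomial.X 0) p q).symm ▸ add_mem hp hq

theorem isConstAddMul_toPoly : IsConstAddMul (toPoly k) (MvPolynomial.X 0) where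
  injective := toPoly_injective k
  mem_range_iff b := by
    rw [range_toPoly]
    rfl

theorem span_X_ne_top :
    Ideal.span {(MvPolynomial.X 0 : MvPolynomial (Fin 2) k), MvPolynomial.X 1} ≠ ⊤ := by
  rw [Ne, Ideal.eq_top_iff_one, Ideal.mem_span_pair]
  rintro ⟨a, b, h⟩
  have := congrArg MvPolynomial.constantCoeff h
  simp at this

theorem ringKrullDim_mvPolynomial_fin_two_le : ringKrullDim (MvPolynomial (Fin 2) k) ≤ 2 := by
  rw [MvPolynomial.ringKrullDim_of_isNoetherianRing, ringKrullDim_eq_zero_of_field]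
  simp

end NonNoethCM

/-! ### The theorem for `k[H]` -/

theorem theorem4p10 (k : Type*) [Field k] :
    NonNoethCM.IsNormalSubmonoid NonNoethCM.HInt ∧
    (∃ e : AddMonoidAlgebra k NonNoethCM.H ≃ₐ[k] NonNoethCM.kAddXPoly k,
      ∀ h : NonNoethCM.H,
        (e (AddMonoidAlgebra.single h 1) : MvPolynomial (Fin 2) k) =
          MvPolynomial.X 0 ^ h.1.1 * MvPolynomial.X 1 ^ h.1.2) ∧
    ¬ NonNoethCM.IsCohenMacaulayIdeals (AddMonoidAlgebra k NonNoethCM.H) ∧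
    ¬ NonNoethCM.IsWeakBourbakiUnmixed (AddMonoidAlgebra k NonNoethCM.H) ∧
    NonNoethCM.IsCohenMacaulayHM (AddMonoidAlgebra k NonNoethCM.H) := by
  have hφ := NonNoethCM.isConstAddMul_toPoly k
  have hX : ¬ (MvPolynomial.X 1 : MvPolynomial (Fin 2) k) ∣ MvPolynomial.X 0 := by
    simp [MvPolynomial.X_dvd_X]
  refine ⟨NonNoethCM.isNormalSubmonoid_HInt,
    ⟨(AlgEquiv.ofInjective (NonNoethCM.toPoly k) hφ.injective).trans
      (Subalgebra.equivOfEq _ _ (NonNoethCM.range_toPoly k)), fun h => ?_⟩,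
    hφ.not_isCohenMacaulayIdeals MvPolynomial.X_prime MvPolynomial.X_prime hX
      (NonNoethCM.span_X_ne_top k),
    hφ.not_isWeakBourbakiUnmixed MvPolynomial.X_prime MvPolynomial.X_prime hX
      (NonNoethCM.span_X_ne_top k),
    hφ.isCohenMacaulayHM MvPolynomial.X_prime (NonNoethCM.ringKrullDim_mvPolynomial_fin_two_le k)⟩
  have := NonNoethCM.toPoly_single k h 1
  rw [map_one, one_mul] at this
  exact this
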